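/- Let $\mathbb{F}$ be a division ring, $n \in \mathbb{N}$, $\sigma : \mathbb{F} \to \mathbb{F}^{n\times n}$ a ring morphism and $\delta : \mathbb{F} \to \mathbb{F}^n$ a $\sigma$-derivation (additive, with $\delta(ab) = \sigma(a)\delta(b) + \delta(a)b$). Let $\mathbb{F}[\mathbf{x};\sigma,\delta]$ be the free multivariate skew polynomial ring: the left $\mathbb{F}$-vector space whose basis is the free monoid $\mathcal{M}$ on $x_1,\dots,x_n$, with product given by appending monomials and by $x_i c = \sum_{j} \sigma_{i,j}(c)x_j + \delta_i(c)$ for $c \in \mathbb{F}$. For $\mathbf{a} \in \mathbb{F}^n$ and $F \in \mathbb{F}[\mathbf{x};\sigma,\delta]$, let $F(\mathbf{a}) \in \mathbb{F}$ be the unique constant such that $F - F(\mathbf{a})$ lies in the left ideal $(x_1-a_1,\dots,x_n-a_n)$, and for $\Omega \subseteq \mathbb{F}^n$ let $I(\Omega)$ be the left ideal of all $F$ with $F(\mathbf{a}) = 0$ for every $\mathbf{a} \in \Omega$. For $\mathbf{a} \in \mathbb{F}^n$ put $\mathcal{D}_{\mathbf{a}}(\beta) = \sigma(\beta)\mathbf{a}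 + \delta(\beta) \in \mathbb{F}^n$ for $\beta \in \mathbb{F}$, and let $\mathcal{D}_{\mathbf{a}}^{\mathfrak{m}} : \mathbb{F} \to \mathbb{F}$, for $\mathfrak{m} \in \mathcal{M}$, be given by $\mathcal{D}_{\mathbf{a}}^{1} = \mathrm{Id}$ and $\mathcal{D}_{\mathbf{a}}^{x_i\mathfrak{m}} = (\mathcal{D}_{\mathbf{a}})_i \circ \mathcal{D}_{\mathbf{a}}^{\mathfrak{m}}$. Let $\mathbb{F}[\mathcal{D}_{\mathbf{a}}]$ be the ring (under composition) formed by the left $\mathbb{F}$-span of the operators $\mathcal{D}_{\mathbf{a}}^{\mathfrak{m}}$, and for $F = \sum_{\mathfrak{m}} F_{\mathfrak{m}}\mathfrak{m}$ write $F^{\mathcal{D}_{\mathbf{a}}} = \sum_{\mathfrak{m}} F_{\mathfrak{m}}\mathcal{D}_{\mathbf{a}}^{\mathfrak{m}}$. Let $K_{\mathbf{a}} = \{\beta \in \mathbb{F} : \mathcal{D}_{\mathbf{a}}(\beta) = \mathbf{a}\beta\}$, a division subring of $\mathbb{F}$, and let $\mathcal{C}(\mathbf{a}) = \{\mathcal{D}_{\mathbf{a}}(\beta)\beta^{-1}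 : \beta \in \mathbb{F}\setminus\{0\}\}$ be the conjugacy class of $\mathbf{a}$. If $\boldsymbol\beta = (\beta_1,\dots,\beta_M)$ is an ordered right basis of $\mathbb{F}$ over $K_{\mathbf{a}}$, let $\mu_{\boldsymbol\beta} : \mathbb{F}^M \to K_{\mathbf{a}}^{M\times M}$ be the bijection sending $(v_1,\dots,v_M)$ to the matrix $(v_j^i)_{i,j}$ with $v_j = \sum_i \beta_i v_j^i$, and put $\mathbf{v} \star_{\boldsymbol\beta} \mathbf{w} = \mu_{\boldsymbol\beta}^{-1}(\mu_{\boldsymbol\beta}(\mathbf{v})\mu_{\boldsymbol\beta}(\mathbf{w}))$. **Corollary.** Let $\mathbf{a}_1,\dots,\mathbf{a}_\ell \in \mathbb{F}^n$ be pairwise non-conjugate, suppose that $M_i = \dim^R_{K_{\mathbf{a}_i}}(\mathbb{F})$, the dimension of $\mathbb{F}$ as a right vector space over $K_{\mathbf{a}_i}$, is finite for $i = 1,\dots,\ell$, and let $\Omega = \mathcal{C}(\mathbf{a}_1)\cup\dots\cup\mathcal{C}(\mathbf{a}_\ell)$. The left ideals $I(\Omega)$ and $I(\mathcal{C}(\mathbf{a}_i))$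 are two-sided, and for all ordered right bases $\boldsymbol\beta_i = (\beta_{i,1},\dots,\beta_{i,M_i})$ of $\mathbb{F}$ over $K_{\mathbf{a}_i}$ there is a chain of ring isomorphisms $$ \mathbb{F}[\mathbf{x};\sigma,\delta]/I(\Omega) \cong \prod_{i=1}^\ell \mathbb{F}[\mathbf{x};\sigma,\delta]/I(\mathcal{C}(\mathbf{a}_i)) \cong \prod_{i=1}^\ell (\mathbb{F}[\mathcal{D}_{\mathbf{a}_i}],\circ) \cong \prod_{i=1}^\ell (\mathbb{F}^{M_i},\star_{\boldsymbol\beta_i}) \cong \prod_{i=1}^\ell K_{\mathbf{a}_i}^{M_i\times M_i}, $$ the first three of which are also left $\mathbb{F}$-linear. They are given, in this order, by $F + I(\Omega) \mapsto (F + I(\mathcal{C}(\mathbf{a}_i)))_i$, by $(F_i + I(\mathcal{C}(\mathbf{a}_i)))_i \mapsto (F_i^{\mathcal{D}_{\mathbf{a}_i}})_i$, by $(f_i)_i \mapsto (f_i(\beta_{i,1}),\dots,f_i(\beta_{i,M_i}))_i$, and by $(\mathbf{v}_i)_i \mapsto (\mu_{\boldsymbol\beta_i}(\mathbf{v}_i))_i$.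 In particular, the ring $\mathbb{F}[\mathbf{x};\sigma,\delta]/I(\Omega)$ is semisimple; that is, every left submodule of a left module over it is a direct summand. -/

import Mathlib

noncomputable section

universe u v

/-- A `σ`-derivation `δ : F → Fⁿ`, for a ring morphism `σ : F → F^{n × n}`: an additive map with
`δ(ab) = σ(a) δ(b) + δ(a) b`. -/
structure SigmaDerivation {F : Type u} [DivisionRing F] {n : ℕ}
    (σ : F →+* Matrix (Fin n) (Fin n) F) extends F →+ (Fin n → F) where
  leibniz' : ∀ a b : F, toFun (a * b) = (σ a).mulVec (toFun b) + fun i => toFun a i * b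

namespace SigmaDerivation

variable {F : Type u} [DivisionRing F] {n : ℕ} {σ : F →+* Matrix (Fin n) (Fin n) F}

instance : CoeFun (SigmaDerivation σ) (fun _ => F → Fin n → F) := ⟨fun δ => δ.toFun⟩

theorem map_add (δ : SigmaDerivation σ) (a b : F) : δ (a + b) = δ a + δ b := δ.map_add' a b

theorem map_zero (δ : SigmaDerivation σ) : δ 0 = 0 := δ.map_zero'

theorem map_mul (δ : SigmaDerivation σ) (a b : F) (i : Fin n) :
    δ (a * b) i = ∑ j, σ a i j * δ b j + δ a i * b := by
  have := congrFun (δ.leibniz' a b) i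
  simpa [Matrix.mulVec, dotProduct] using this

theorem map_one (δ : SigmaDerivation σ) : δ 1 = 0 := by
  funext i
  have h := δ.map_mul 1 1 i
  simpa [Matrix.one_apply] using h

/-! ### Families of operators obeying the commutation rule -/

section Ext

variable {V : Type v} [AddCommGroup V] [Module F V]

theorem end_add (f g : AddMonoid.End V) (v : V) : (f + g) v = f v + g v := rfl

theorem end_sub (f g : AddMonoid.End V) (v : V) : (f - g) v = f v - g v := rfl

theorem end_zero (v : V) : (0 : AddMonoid.End V) v = 0 := rfl

theorem end_one (v : V) : (1 : AddMonoid.End V) v = v := rfl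

theorem end_mul (f g : AddMonoid.End V) (v : V) : (f * g) v = f (g v) := rfl

theorem end_sum {ι : Type*} (s : Finset ι) (f : ι → AddMonoid.End V) (v : V) :
    (∑ i ∈ s, f i) v = ∑ i ∈ s, f i v := AddMonoidHom.finsetSum_apply f s v

/-- The operators `Y₁, …, Yₙ` satisfy `Yᵢ ∘ c = ∑ⱼ σᵢⱼ(c) Yⱼ + δᵢ(c)`. -/
def Rule (δ : SigmaDerivation σ) (Y : Fin n → AddMonoid.End V) : Prop :=
  ∀ (i : Fin n) (c : F) (v : V), Y i (c • v) = ∑ j, σ c i j • Y j v + δ c i • v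

/-- The additive map `∑ F_m m ↦ ∑ F_m Y^m`, where `Y^m` is the composition of the operators `Yᵢ`
along the monomial `m`. -/
def ext (Y : Fin n → AddMonoid.End V) : (FreeMonoid (Fin n) →₀ F) →ₗ[F] AddMonoid.End V :=
  Finsupp.linearCombination F (fun m => FreeMonoid.lift Y m)

theorem ext_single (Y : Fin n → AddMonoid.End V) (m : FreeMonoid (Fin n)) (c : F) (v : V) :
    ext Y (Finsupp.single m c) v = c • FreeMonoid.lift Y m v := by
  simp [ext]

end Ext

/-! ### The free multivariate skew polynomial ring -/

/-- The free skew polynomial ring `F[x; σ, δ]`: as a left vector space it has the free monoid on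
`n` letters as a basis. -/
def Poly (_δ : SigmaDerivation σ) : Type u := FreeMonoid (Fin n) →₀ F

variable (δ : SigmaDerivation σ)

instance : AddCommGroup δ.Poly := inferInstanceAs (AddCommGroup (FreeMonoid (Fin n) →₀ F))

instance : Module F δ.Poly := inferInstanceAs (Module F (FreeMonoid (Fin n) →₀ F))

/-- The term `c m`, for a constant `c` and a monomial `m`. -/
def term (m : FreeMonoid (Fin n)) (c : F) : δ.Poly := Finsupp.single m c

theorem term_add (m : FreeMonoid (Fin n)) (c d : F) :
    δ.term m (c + d) = δ.term m c + δ.term m d := Finsupp.single_add m c d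

theorem term_zero (m : FreeMonoid (Fin n)) : δ.term m 0 = 0 := Finsupp.single_zero m

theorem smul_term (b : F) (m : FreeMonoid (Fin n)) (c : F) :
    b • δ.term m c = δ.term m (b * c) := Finsupp.smul_single' b m c

theorem poly_induction {p : δ.Poly → Prop} (P : δ.Poly) (h0 : p 0)
    (hadd : ∀ P Q, p P → p Q → p (P + Q)) (ht : ∀ m c, p (δ.term m c)) : p P :=
  Finsupp.induction_linear P h0 hadd ht

/-- Left multiplication by the variable `xᵢ`:
`xᵢ (c m) = ∑ⱼ σᵢⱼ(c) xⱼ m + δᵢ(c) m`. -/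
def mulX (i : Fin n) : AddMonoid.End δ.Poly :=
  (Finsupp.liftAddHom (fun m : FreeMonoid (Fin n) =>
    ({ toFun := fun c => ∑ j, δ.term (FreeMonoid.of j * m) (σ c i j) + δ.term m (δ c i)
       map_zero' := by simp [term_zero, map_zero]
       map_add' := fun c d => by
        simp only [_root_.map_add, Matrix.add_apply, map_add, Pi.add_apply, term_add,
          Finset.sum_add_distrib]
        abel } : F →+ δ.Poly)) : (FreeMonoid (Fin n) →₀ F) →+ δ.Poly)

theorem mulX_term (i : Fin n) (m : FreeMonoid (Fin n)) (c : F) :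
    δ.mulX i (δ.term m c) =
      ∑ j, δ.term (FreeMonoid.of j * m) (σ c i j) + δ.term m (δ c i) :=
  Finsupp.liftAddHom_apply_single _ _ _

theorem mulX_rule : δ.Rule δ.mulX := by
  intro i c P
  induction P using poly_induction with
  | h0 => simp
  | hadd P Q hP hQ =>
    simp only [smul_add, _root_.map_add, hP, hQ, Finset.sum_add_distrib]
    abel
  | ht m d =>
    have hσ : ∀ k, δ.term (FreeMonoid.of k * m) (σ (c * d) i k)
        = ∑ j, δ.term (FreeMonoid.of k * m) (σ c i j * σ d j k) := by
      intro k
      rw [_root_.map_mul, Matrix.mul_apply]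
      exact _root_.map_sum (Finsupp.singleAddHom (FreeMonoid.of k * m)) _ _
    have hδ : δ.term m (δ (c * d) i)
        = ∑ j, δ.term m (σ c i j * δ d j) + δ.term m (δ c i * d) := by
      rw [map_mul, term_add]
      congr 1
      exact _root_.map_sum (Finsupp.singleAddHom m) _ _
    simp only [smul_term, mulX_term, smul_add, Finset.smul_sum, Finset.sum_add_distrib, hσ, hδ]
    rw [Finset.sum_comm]
    abel

instance : Mul δ.Poly := ⟨fun P Q => ext (F := F) δ.mulX P Q⟩

instance : One δ.Poly := ⟨δ.term 1 1⟩

theorem mul_def (P Q : δ.Poly) : P * Q = ext (F := F) δ.mulX P Q := rfl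

theorem one_def : (1 : δ.Poly) = δ.term 1 1 := rfl

section Ext

variable {V : Type v} [AddCommGroup V] [Module F V] {Y : Fin n → AddMonoid.End V}

/-- The additive map `ext Y`, on skew polynomials. -/
def extP (Y : Fin n → AddMonoid.End V) : δ.Poly →ₗ[F] AddMonoid.End V := ext Y

theorem mul_extP (P Q : δ.Poly) : P * Q = δ.extP δ.mulX P Q := rfl

theorem extP_term (m : FreeMonoid (Fin n)) (c : F) (v : V) :
    δ.extP Y (δ.term m c) v = c • FreeMonoid.lift Y m v := ext_single Y m c v

theorem extP_mulX (hY : δ.Rule Y) (i : Fin n) (Q : δ.Poly) (v : V) :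
    δ.extP Y (δ.mulX i Q) v = Y i (δ.extP Y Q v) := by
  induction Q using poly_induction with
  | h0 => simp
  | hadd P Q hP hQ => simp [end_add, hP, hQ]
  | ht m c =>
    rw [mulX_term, extP_term, hY i c]
    simp [extP_term, end_add, end_sum]

theorem extP_mul (hY : δ.Rule Y) (P Q : δ.Poly) (v : V) :
    δ.extP Y (P * Q) v = δ.extP Y P (δ.extP Y Q v) := by
  induction P using poly_induction with
  | h0 =>
    have : (0 : δ.Poly) * Q = 0 := by rw [mul_extP, _root_.map_zero, end_zero]
    rw [this]
    simp
  | hadd P P' hP hP' =>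
    have : (P + P') * Q = P * Q + P' * Q := by simp only [mul_extP, _root_.map_add, end_add]
    rw [this]
    simp [end_add, hP, hP']
  | ht m c =>
    have h1 : δ.term m c * Q = c • FreeMonoid.lift δ.mulX m Q := ext_single δ.mulX m c Q
    have h2 : ∀ R : δ.Poly, δ.extP Y (FreeMonoid.lift δ.mulX m R) v
        = FreeMonoid.lift Y m (δ.extP Y R v) := by
      intro R
      clear h1
      induction m using FreeMonoid.inductionOn' with
      | one => simp [end_one]
      | of_mul i m ih => simp [end_mul, extP_mulX δ hY, ih]
    rw [h1, extP_term, map_smul, ← h2]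
    rfl

end Ext

theorem lift_mulX_term (m m' : FreeMonoid (Fin n)) :
    FreeMonoid.lift δ.mulX m (δ.term m' 1) = δ.term (m * m') 1 := by
  induction m using FreeMonoid.inductionOn' with
  | one => simp
  | of_mul i m ih =>
    rw [_root_.map_mul, end_mul, ih, FreeMonoid.lift_eval_of, mulX_term]
    simp [Matrix.one_apply, map_one, term_zero, mul_assoc, apply_ite, Finset.sum_ite_eq]

/-- The ring `F[x; σ, δ]`. -/
instance : Ring δ.Poly where
  __ := (inferInstance : AddCommGroup δ.Poly)
  mul_assoc P Q R := by simpa only [mul_extP] using δ.extP_mul δ.mulX_rule P Q R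
  one_mul P := by
    rw [mul_extP, one_def, extP_term]; simp
  mul_one P := by
    induction P using poly_induction with
    | h0 => rw [mul_extP, _root_.map_zero, end_zero]
    | hadd P Q hP hQ => rw [mul_extP] at *; rw [_root_.map_add, end_add, hP, hQ]
    | ht m c =>
      rw [mul_extP, one_def, extP_term, lift_mulX_term, smul_term]; simp
  zero_mul P := by rw [mul_extP, _root_.map_zero, end_zero]
  mul_zero P := by rw [mul_extP, _root_.map_zero]
  left_distrib P Q R := by simp only [mul_extP, _root_.map_add]
  right_distrib P Q R := by simp only [mul_extP, _root_.map_add, end_add]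

instance : IsScalarTower F δ.Poly δ.Poly :=
  ⟨fun c P Q => by rw [smul_eq_mul, smul_eq_mul, mul_extP, map_smul]; rfl⟩

/-- The constants. -/
def C (c : F) : δ.Poly := δ.term 1 c

/-- The variables `xᵢ`. -/
def X (i : Fin n) : δ.Poly := δ.term (FreeMonoid.of i) 1

theorem C_mul (c : F) (P : δ.Poly) : δ.C c * P = c • P := by
  rw [mul_extP, C, extP_term]; simp

theorem C_one : δ.C 1 = 1 := rfl

theorem C_mul_C (c d : F) : δ.C (c * d) = δ.C c * δ.C d := by
  rw [C_mul, C, C, smul_term]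

/-- Products of monomials are given by appending. -/
theorem term_mul_term (m m' : FreeMonoid (Fin n)) :
    δ.term m 1 * δ.term m' 1 = δ.term (m * m') 1 := by
  rw [mul_extP, extP_term, lift_mulX_term, one_smul]

/-- The defining rule of the product. -/
theorem X_mul_C (i : Fin n) (c : F) :
    δ.X i * δ.C c = ∑ j, δ.C (σ c i j) * δ.X j + δ.C (δ c i) := by
  rw [mul_extP, X, extP_term, one_smul, FreeMonoid.lift_eval_of, C, mulX_term]
  simp only [C_mul, X, smul_term, mul_one]
  rfl

/-! ### The operators `D_a`, linearized polynomials, centralizers and conjugacy -/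

/-- The component `β ↦ (σ(β) a + δ(β))ᵢ` of the operator `D_a : F → Fⁿ`. -/
def D (a : Fin n → F) (i : Fin n) : AddMonoid.End F where
  toFun β := ((σ β).mulVec a + δ β) i
  map_zero' := by simp [map_zero]
  map_add' β γ := by
    simp only [_root_.map_add, Matrix.add_mulVec, map_add, Pi.add_apply]
    abel

theorem D_apply (a : Fin n → F) (i : Fin n) (β : F) :
    δ.D a i β = ∑ j, σ β i j * a j + δ β i := rfl

theorem D_mul (a : Fin n → F) (i : Fin n) (β γ : F) :
    δ.D a i (β * γ) = ∑ j, σ β i j * δ.D a j γ + δ β i * γ := by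
  simp only [D_apply, map_mul, _root_.map_mul, Matrix.mul_apply, mul_add, Finset.sum_add_distrib,
    Finset.mul_sum, Finset.sum_mul, mul_assoc]
  rw [Finset.sum_comm, add_assoc]

theorem D_one (a : Fin n → F) (i : Fin n) : δ.D a i 1 = a i := by
  simp [D_apply, Matrix.one_apply, map_one]

theorem D_rule (a : Fin n → F) : δ.Rule (δ.D a) := fun i c v => δ.D_mul a i c v

/-- The operator `D_a^m : F → F` of a monomial `m`, so that `D_a^{xᵢ m} = D_a^{xᵢ} ∘ D_a^m`. -/
def Dmon (a : Fin n → F) (m : FreeMonoid (Fin n)) : AddMonoid.End F :=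
  FreeMonoid.lift (δ.D a) m

/-- The ring morphism `φ_a : F ↦ F^{D_a} = ∑ F_m D_a^m`, into the additive operators of `F`
under composition. -/
def phi (a : Fin n → F) : δ.Poly →+* AddMonoid.End F where
  toFun P := Finsupp.linearCombination F (δ.Dmon a) P
  map_zero' := _root_.map_zero _
  map_add' P Q := _root_.map_add (Finsupp.linearCombination F (δ.Dmon a)) P Q
  map_one' := by
    refine AddMonoidHom.ext fun v => ?_
    exact (δ.extP_term (Y := δ.D a) 1 1 v).trans (by rw [one_smul, _root_.map_one]; rfl)
  map_mul' P Q := AddMonoidHom.ext fun v => δ.extP_mul (δ.D_rule a) P Q v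

theorem phi_term (a : Fin n → F) (m : FreeMonoid (Fin n)) (c β : F) :
    δ.phi a (δ.term m c) β = c * δ.Dmon a m β := δ.extP_term m c β

theorem phi_C (a : Fin n → F) (c β : F) : δ.phi a (δ.C c) β = c * β := by
  rw [C, phi_term]; simp [Dmon]

theorem phi_X (a : Fin n → F) (i : Fin n) (β : F) : δ.phi a (δ.X i) β = δ.D a i β := by
  rw [X, phi_term]; simp [Dmon]

theorem phi_smul (a : Fin n → F) (c : F) (P : δ.Poly) : δ.phi a (c • P) = c • δ.phi a P :=
  map_smul (Finsupp.linearCombination F (δ.Dmon a)) c P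

/-- The left vector space of linearized polynomials: the left span of the operators `D_a^m`. -/
def linSpan (a : Fin n → F) : Submodule F (AddMonoid.End F) :=
  Submodule.span F (Set.range (δ.Dmon a))

theorem mem_linSpan (a : Fin n → F) (f : AddMonoid.End F) :
    f ∈ δ.linSpan a ↔ ∃ P, δ.phi a P = f := by
  rw [linSpan, ← Finsupp.range_linearCombination]
  rfl

/-- The ring `F[D_a]` of linearized polynomials, with composition as product. -/
def LinPoly (a : Fin n → F) : Subring (AddMonoid.End F) where
  carrier := δ.linSpan a
  zero_mem' := (δ.linSpan a).zero_mem
  add_mem' := (δ.linSpan a).add_mem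
  neg_mem' := (δ.linSpan a).neg_mem
  one_mem' := (δ.mem_linSpan a _).2 ⟨1, _root_.map_one _⟩
  mul_mem' := by
    intro f g hf hg
    obtain ⟨P, rfl⟩ := (δ.mem_linSpan a _).1 hf
    obtain ⟨Q, rfl⟩ := (δ.mem_linSpan a _).1 hg
    exact (δ.mem_linSpan a _).2 ⟨P * Q, _root_.map_mul _ _ _⟩

instance (a : Fin n → F) : Module F (δ.LinPoly a) :=
  inferInstanceAs (Module F (δ.linSpan a))

/-- The centralizer `K_a = {β | D_a(β) = a β}`, a division subring of `F`. -/
def centralizer (a : Fin n → F) : Subfield F where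
  carrier := {β | ∀ i, δ.D a i β = a i * β}
  zero_mem' i := by simp
  one_mem' i := by simp [D_one]
  add_mem' {β γ} hβ hγ i := by simp [hβ i, hγ i, mul_add]
  neg_mem' {β} hβ i := by simp [hβ i]
  mul_mem' {β γ} hβ hγ i := by
    rw [D_mul]
    simp only [hγ _, ← mul_assoc, ← Finset.sum_mul, ← add_mul]
    rw [← D_apply, hβ i]
  inv_mem' β hβ i := by
    by_cases h : β = 0
    · simp [h]
    · have key : a i = δ.D a i β⁻¹ * β := by
        rw [← δ.D_one a i, ← inv_mul_cancel₀ h, D_mul]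
        simp only [hβ _, ← mul_assoc, ← Finset.sum_mul, ← add_mul]
        rw [← D_apply]
      rw [key, mul_assoc, mul_inv_cancel₀ h, mul_one]

/-- `F` as a right vector space over `K_a`: `β · λ = β λ`. -/
instance rightModule (a : Fin n → F) : Module (δ.centralizer a)ᵐᵒᵖ F where
  smul k β := β * (k.unop : F)
  one_smul β := mul_one β
  mul_smul k l β := (mul_assoc β (l.unop : F) (k.unop : F)).symm
  smul_zero _ := zero_mul _
  smul_add _ _ _ := add_mul _ _ _
  add_smul k l β := mul_add β (k.unop : F) (l.unop : F)
  zero_smul β := mul_zero β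

theorem op_smul_def (a : Fin n → F) (k : (δ.centralizer a)ᵐᵒᵖ) (β : F) :
    k • β = β * (k.unop : F) := rfl

/-- The conjugacy class `C(a) = {D_a(β) β⁻¹ | β ∈ F \ {0}}`. -/
def conjClass (a : Fin n → F) : Set (Fin n → F) :=
  {b | ∃ β : F, β ≠ 0 ∧ b = fun i => δ.D a i β * β⁻¹}

/-! ### Skew evaluation and vanishing ideals -/

/-- The left ideal `(x₁ - a₁, …, xₙ - aₙ)`. -/
def pointIdeal (a : Fin n → F) : Ideal δ.Poly :=
  Ideal.span (Set.range fun i => δ.X i - δ.C (a i))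

theorem phi_of_mem_pointIdeal (a b : Fin n → F) (β : F) (h : ∀ i, δ.D a i β = b i * β)
    {P : δ.Poly} (hP : P ∈ δ.pointIdeal b) : δ.phi a P β = 0 := by
  refine Submodule.span_induction (p := fun P _ => δ.phi a P β = 0) ?_ ?_ ?_ ?_ hP
  · rintro _ ⟨i, rfl⟩
    simp [end_sub, phi_X, phi_C, h i]
  · simp
  · intro P Q _ _ hP hQ
    simp [end_add, hP, hQ]
  · intro P Q _ hQ
    simp [smul_eq_mul, hQ]

theorem C_mem_pointIdeal (a : Fin n → F) {c : F} (h : δ.C c ∈ δ.pointIdeal a) : c = 0 := by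
  have := δ.phi_of_mem_pointIdeal a a 1 (fun i => by simp [D_one]) h
  simpa [phi_C] using this

theorem C_add (c d : F) : δ.C (c + d) = δ.C c + δ.C d := δ.term_add 1 c d

theorem C_sub (c d : F) : δ.C (c - d) = δ.C c - δ.C d := Finsupp.single_sub _ _ _

theorem C_sum (c : Fin n → F) : δ.C (∑ j, c j) = ∑ j, δ.C (c j) :=
  _root_.map_sum (Finsupp.singleAddHom (1 : FreeMonoid (Fin n))) c _

theorem exists_eval_term (a : Fin n → F) (m : FreeMonoid (Fin n)) :
    ∃ c, δ.term m 1 - δ.C c ∈ δ.pointIdeal a := by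
  induction m using FreeMonoid.inductionOn' with
  | one => exact ⟨1, by rw [C, sub_self]; exact Ideal.zero_mem _⟩
  | of_mul i m ih =>
    obtain ⟨c, hc⟩ := ih
    refine ⟨∑ j, σ c i j * a j + δ c i, ?_⟩
    have h2 : δ.term (FreeMonoid.of i * m) 1 = δ.X i * δ.term m 1 := (δ.term_mul_term _ _).symm
    have h3 : δ.term (FreeMonoid.of i * m) 1 - δ.C (∑ j, σ c i j * a j + δ c i)
        = δ.X i * (δ.term m 1 - δ.C c) + ∑ j, δ.C (σ c i j) * (δ.X j - δ.C (a j)) := by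
      rw [h2, mul_sub, X_mul_C, C_add, C_sum]
      simp only [mul_sub, Finset.sum_sub_distrib, C_mul_C]
      abel
    rw [h3]
    exact Ideal.add_mem _ (Ideal.mul_mem_left _ _ hc)
      (Ideal.sum_mem _ fun j _ => Ideal.mul_mem_left _ _ (Ideal.subset_span ⟨j, rfl⟩))

theorem existsUnique_eval (a : Fin n → F) (P : δ.Poly) :
    ∃! c : F, P - δ.C c ∈ δ.pointIdeal a := by
  refine existsUnique_of_exists_of_unique ?_ ?_
  · induction P using poly_induction with
    | h0 => exact ⟨0, by simp [C, term_zero]⟩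
    | hadd P Q hP hQ =>
      obtain ⟨c, hc⟩ := hP
      obtain ⟨d, hd⟩ := hQ
      exact ⟨c + d, by rw [C_add, add_sub_add_comm]; exact Ideal.add_mem _ hc hd⟩
    | ht m c =>
      obtain ⟨d, hd⟩ := δ.exists_eval_term a m
      refine ⟨c * d, ?_⟩
      have : δ.term m c - δ.C (c * d) = δ.C c * (δ.term m 1 - δ.C d) := by
        rw [mul_sub, C_mul, smul_term, mul_one, C_mul_C]
      rw [this]
      exact Ideal.mul_mem_left _ _ hd
  · intro c d hc hd
    have := Ideal.sub_mem _ hd hc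
    rw [sub_sub_sub_cancel_left, ← C_sub] at this
    exact sub_eq_zero.1 (δ.C_mem_pointIdeal a this)

/-- The skew evaluation `F(a)`: the unique constant with `F - F(a) ∈ (x₁ - a₁, …, xₙ - aₙ)`. -/
def eval (a : Fin n → F) (P : δ.Poly) : F := (δ.existsUnique_eval a P).choose

theorem eval_spec (a : Fin n → F) (P : δ.Poly) : P - δ.C (δ.eval a P) ∈ δ.pointIdeal a :=
  (δ.existsUnique_eval a P).choose_spec.1

theorem eval_eq_zero_iff (a : Fin n → F) (P : δ.Poly) :
    δ.eval a P = 0 ↔ P ∈ δ.pointIdeal a := by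
  constructor
  · intro h
    simpa [h, C, term_zero] using δ.eval_spec a P
  · intro h
    refine (δ.existsUnique_eval a P).unique (δ.eval_spec a P) ?_
    simpa [C, term_zero] using h

/-- The left ideal `I(Ω)` of the skew polynomials that vanish on `Ω`. -/
def vanishing (Ω : Set (Fin n → F)) : Ideal δ.Poly where
  carrier := {P | ∀ a ∈ Ω, δ.eval a P = 0}
  zero_mem' a _ := (δ.eval_eq_zero_iff a 0).2 (Ideal.zero_mem _)
  add_mem' hP hQ a ha := (δ.eval_eq_zero_iff a _).2
    (Ideal.add_mem _ ((δ.eval_eq_zero_iff a _).1 (hP a ha)) ((δ.eval_eq_zero_iff a _).1 (hQ a ha)))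
  smul_mem' R _ hP a ha := (δ.eval_eq_zero_iff a _).2
    (Ideal.mul_mem_left _ R ((δ.eval_eq_zero_iff a _).1 (hP a ha)))

theorem mem_vanishing_conjClass (a : Fin n → F) (P : δ.Poly) :
    P ∈ δ.vanishing (δ.conjClass a) ↔ δ.phi a P = 0 := by
  have key : ∀ β : F, β ≠ 0 →
      δ.phi a P β = δ.eval (fun i => δ.D a i β * β⁻¹) P * β := by
    intro β hβ
    have := δ.phi_of_mem_pointIdeal a (fun i => δ.D a i β * β⁻¹) β
      (fun i => by simp [mul_assoc, inv_mul_cancel₀ hβ]) (δ.eval_spec _ P)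
    rw [map_sub, end_sub, phi_C, sub_eq_zero] at this
    exact this
  constructor
  · intro h
    refine DFunLike.ext _ _ fun β => ?_
    by_cases hβ : β = 0
    · simp [hβ]
    · rw [key β hβ, h _ ⟨β, hβ, rfl⟩, zero_mul, end_zero]
  · rintro h _ ⟨β, hβ, rfl⟩
    have := key β hβ
    rw [h] at this
    exact (mul_eq_zero.1 this.symm).resolve_right hβ

instance (a : Fin n → F) : (δ.vanishing (δ.conjClass a)).IsTwoSided :=
  ⟨fun Q hP => by
    rw [mem_vanishing_conjClass] at *
    rw [_root_.map_mul, hP, zero_mul]⟩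

instance {ι : Type*} (a : ι → Fin n → F) :
    (δ.vanishing (⋃ i, δ.conjClass (a i))).IsTwoSided :=
  ⟨fun {P} Q hP b hb => by
    obtain ⟨i, hi⟩ := Set.mem_iUnion.1 hb
    have : P ∈ δ.vanishing (δ.conjClass (a i)) := fun c hc => hP c (Set.mem_iUnion.2 ⟨i, hc⟩)
    exact Ideal.mul_mem_right Q _ this b hi⟩

/-! ### The ring `F^M` with the matrix product of a right basis -/

section Star

variable {δ} {a : Fin n → F} {M : ℕ}

/-- The matrix-representation map `μ_β : F^M → K_a^{M × M}`: column `j` of `μ_β(x)` holds the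
right coordinates of `x_j` in the basis `β`, that is `x_j = ∑ᵢ βᵢ μ_β(x)ᵢⱼ`. -/
def mu (β : Module.Basis (Fin M) (δ.centralizer a)ᵐᵒᵖ F) :
    (Fin M → F) ≃+ Matrix (Fin M) (Fin M) (δ.centralizer a) where
  toFun x := Matrix.of fun i j => (β.repr (x j) i).unop
  invFun A j := ∑ i, β i * (A i j : F)
  left_inv x := funext fun j => β.sum_repr (x j)
  right_inv A := by
    ext i j
    have : ∑ i, β i * (A i j : F) = ∑ i, MulOpposite.op (A i j) • β i := rfl
    simp only [Matrix.of_apply, this, β.repr_sum_self, MulOpposite.unop_op]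
  map_add' x y := by
    ext i j
    simp

/-- The left vector space `F^M` with the matrix product `⋆` of the ordered right basis `β`. -/
def StarVec (_β : Module.Basis (Fin M) (δ.centralizer a)ᵐᵒᵖ F) : Type u := Fin M → F

variable (β : Module.Basis (Fin M) (δ.centralizer a)ᵐᵒᵖ F)

instance : AddCommGroup (StarVec β) := inferInstanceAs (AddCommGroup (Fin M → F))

instance : Module F (StarVec β) := inferInstanceAs (Module F (Fin M → F))

instance : Mul (StarVec β) := ⟨fun x y => (mu β).symm (mu β x * mu β y)⟩

instance : One (StarVec β) := ⟨(mu β).symm 1⟩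

/-- The map `μ_β`, on `(F^M, ⋆)`. -/
def muS : StarVec β ≃+ Matrix (Fin M) (Fin M) (δ.centralizer a) := mu β

theorem muS_mul (x y : StarVec β) : muS β (x * y) = muS β x * muS β y :=
  (mu β).apply_symm_apply _

theorem muS_one : muS β 1 = 1 := (mu β).apply_symm_apply _

instance : Ring (StarVec β) where
  __ := (inferInstance : AddCommGroup (StarVec β))
  mul_assoc x y z := (muS β).injective (by simp only [muS_mul, mul_assoc])
  one_mul x := (muS β).injective (by simp only [muS_mul, muS_one, one_mul])
  mul_one x := (muS β).injective (by simp only [muS_mul, muS_one, mul_one])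
  zero_mul x := (muS β).injective (by simp only [muS_mul, _root_.map_zero, zero_mul])
  mul_zero x := (muS β).injective (by simp only [muS_mul, _root_.map_zero, mul_zero])
  left_distrib x y z := (muS β).injective (by simp only [muS_mul, _root_.map_add, mul_add])
  right_distrib x y z := (muS β).injective (by simp only [muS_mul, _root_.map_add, add_mul])

end Star

end SigmaDerivation

end

/-!
Each point `a` makes `F` a simple `F[x; σ, δ]`-module, in which `P` acts as `P^{D_a}`; this is
`F[x; σ, δ] / (x₁ - a₁, …, xₙ - aₙ)`. A homomorphism from the module of `b` to that of `a` is the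
right multiplication by some `m` with `D_a(m) = b m`. So the module of `a` has the endomorphism
ring `K_a`, and modules of non-conjugate points admit no nonzero homomorphisms. By the Jacobson
density theorem for the direct sum of the modules of the `aᵢ`, the skew polynomials realize every
family of `K_{aᵢ}`-linear operators simultaneously. This is at once the Chinese remainder theorem
and the surjectivity of the matrix representations. The kernel of `P ↦ P^{D_a}` is `I(C(a))`,
because `P^{D_a}(β) = P(b) β` at the conjugate `b = D_a(β) β⁻¹` of `a`.
-/

noncomputable section

section Density

variable {R ι : Type*} [Ring R] [Finite ι] {M : ι → Type*} [∀ i, AddCommGroup (M i)]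
  [∀ i, Module R (M i)]

theorem end_pi_apply_of_hom_eq_zero [DecidableEq ι]
    (hM : Pairwise fun i j => ∀ g : M i →ₗ[R] M j, g = 0)
    (g : Module.End R (∀ i, M i)) (x : ∀ i, M i) (i : ι) :
    g x i = (LinearMap.proj i ∘ₗ g ∘ₗ LinearMap.single R M i) (x i) := by
  cases nonempty_fintype ι
  let entry (j : ι) : M j →ₗ[R] M i := LinearMap.proj i ∘ₗ g ∘ₗ LinearMap.single R M j
  calc g x i = ∑ j, entry j (x j) := by
        conv_lhs => rw [← LinearMap.sum_single_apply (φ := M) x]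
        simp [entry]
    _ = entry i (x i) := Fintype.sum_eq_single i fun j hj => by
        rw [hM hj (entry j), LinearMap.zero_apply]

theorem jacobson_density_pi [∀ i, IsSemisimpleModule R (M i)]
    (hM : Pairwise fun i j => ∀ g : M i →ₗ[R] M j, g = 0)
    (f : ∀ i, Module.End (Module.End R (M i)) (M i)) (s : ∀ i, Finset (M i)) :
    ∃ r : R, ∀ i, ∀ m ∈ s i, f i m = r • m := by
  classical
  cases nonempty_fintype ι
  let fPi : Module.End (Module.End R (∀ i, M i)) (∀ i, M i) :=
    { toFun := fun x i => f i (x i)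
      map_add' := fun x y => funext fun i => (f i).map_add (x i) (y i)
      map_smul' := fun g x => funext fun i => by
        simp only [Module.End.smul_def, RingHom.id_apply, end_pi_apply_of_hom_eq_zero hM g]
        exact (f i).map_smul (LinearMap.proj i ∘ₗ g ∘ₗ LinearMap.single R M i) (x i) }
  obtain ⟨r, hr⟩ := jacobson_density fPi
    ((Finset.univ.sigma s).image fun p : Σ i, M i => (Pi.single p.1 p.2 : ∀ i, M i))
  refine ⟨r, fun i m hm => ?_⟩
  have hi := congrFun (hr (Pi.single i m) (Finset.mem_image_of_mem _
    (Finset.mem_sigma.2 ⟨Finset.mem_univ i, hm⟩ : (⟨i, m⟩ : Σ i, M i) ∈ Finset.univ.sigma s))) i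
  simpa only [fPi, LinearMap.coe_mk, AddHom.coe_mk, Pi.smul_apply, Pi.single_eq_same] using hi

end Density

namespace SigmaDerivation

variable {F : Type*} [DivisionRing F] {n : ℕ} {σ : F →+* Matrix (Fin n) (Fin n) F}
  (δ : SigmaDerivation σ)

theorem phi_apply_eq_eval_mul {a b : Fin n → F} {β : F} (h : ∀ i, δ.D a i β = b i * β)
    (P : δ.Poly) : δ.phi a P β = δ.eval b P * β := by
  have hP := δ.phi_of_mem_pointIdeal a b β h (δ.eval_spec b P)
  rwa [map_sub, end_sub, phi_C, sub_eq_zero] at hP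

theorem D_mul_of_mem_centralizer {a : Fin n → F} (i : Fin n) (β : F) {k : F}
    (hk : k ∈ δ.centralizer a) : δ.D a i (β * k) = δ.D a i β * k := by
  have hDk : ∀ j, δ.D a j k = a j * k := hk
  rw [D_mul, D_apply, add_mul, Finset.sum_mul]
  simp only [hDk, mul_assoc]

theorem phi_mul_of_mem_centralizer {a : Fin n → F} (P : δ.Poly) (β : F) {k : F}
    (hk : k ∈ δ.centralizer a) : δ.phi a P (β * k) = δ.phi a P β * k := by
  rcases eq_or_ne β 0 with rfl | hβ
  · simp
  -- `β` and `β * k` lead to the same conjugate `D_a(β) β⁻¹` of `a`.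
  · have hDβ : ∀ i, δ.D a i β = δ.D a i β * β⁻¹ * β := fun i => (inv_mul_cancel_right₀ hβ _).symm
    have hDβk : ∀ i, δ.D a i (β * k) = δ.D a i β * β⁻¹ * (β * k) := fun i => by
      rw [δ.D_mul_of_mem_centralizer i β hk, ← mul_assoc, ← hDβ]
    rw [δ.phi_apply_eq_eval_mul hDβ, δ.phi_apply_eq_eval_mul hDβk, mul_assoc]

/-- The `F[x; σ, δ]`-module `F[x; σ, δ] / (x₁ - a₁, …, xₙ - aₙ)`, realized on `F` by the action
`P • β = P^{D_a}(β)`. -/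
def PointModule (_δ : SigmaDerivation σ) (_a : Fin n → F) : Type _ := F

namespace PointModule

variable (a : Fin n → F)

instance : AddCommGroup (δ.PointModule a) := inferInstanceAs (AddCommGroup F)

instance : Module δ.Poly (δ.PointModule a) := Module.compHom F (δ.phi a)

/-- The identity of `F`, with values in the point module. -/
def of : F ≃+ δ.PointModule a := AddEquiv.refl F

theorem smul_of (P : δ.Poly) (β : F) : P • of δ a β = of δ a (δ.phi a P β) := rfl

instance : IsSimpleModule δ.Poly (δ.PointModule a) := by
  rw [isSimpleModule_iff_toSpanSingleton_surjective]
  refine ⟨inferInstanceAs (Nontrivial F), fun x hx y => ?_⟩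
  obtain ⟨β, rfl⟩ := (of δ a).surjective x
  obtain ⟨γ, rfl⟩ := (of δ a).surjective y
  have hβ : β ≠ 0 := (map_ne_zero_iff _ (of δ a).injective).1 hx
  exact ⟨δ.C (γ * β⁻¹), by
    rw [LinearMap.toSpanSingleton_apply, smul_of, phi_C, inv_mul_cancel_right₀ hβ]⟩

variable {δ a} {b : Fin n → F}

/-- The image of `1` under a homomorphism of point modules. The homomorphism is the right
multiplication by this constant. -/
def homMultiplier (g : δ.PointModule b →ₗ[δ.Poly] δ.PointModule a) : F :=
  (of δ a).symm (g (of δ b 1))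

theorem hom_of (g : δ.PointModule b →ₗ[δ.Poly] δ.PointModule a) (β : F) :
    g (of δ b β) = of δ a (β * homMultiplier g) :=
  calc g (of δ b β) = g (δ.C β • of δ b 1) := by rw [smul_of, phi_C, mul_one]
    _ = δ.C β • of δ a (homMultiplier g) := g.map_smul _ _
    _ = of δ a (β * homMultiplier g) := by rw [smul_of, phi_C]

theorem D_homMultiplier (g : δ.PointModule b →ₗ[δ.Poly] δ.PointModule a) (i : Fin n) :
    δ.D a i (homMultiplier g) = b i * homMultiplier g :=
  (of δ a).injective <|
    calc of δ a (δ.D a i (homMultiplier g)) = δ.X i • of δ a (homMultiplier g) := by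
          rw [smul_of, phi_X]
      _ = g (δ.X i • of δ b 1) := (g.map_smul _ _).symm
      _ = of δ a (b i * homMultiplier g) := by rw [smul_of, phi_X, D_one, hom_of]

theorem hom_eq_zero (hab : b ∉ δ.conjClass a)
    (g : δ.PointModule b →ₗ[δ.Poly] δ.PointModule a) : g = 0 := by
  have hg : homMultiplier g = 0 := by
    by_contra hg
    exact hab ⟨_, hg, funext fun i => by rw [D_homMultiplier, mul_inv_cancel_right₀ hg]⟩
  refine LinearMap.ext fun x => ?_
  obtain ⟨β, rfl⟩ := (of δ b).surjective x
  rw [hom_of, hg, mul_zero, _root_.map_zero, LinearMap.zero_apply]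

/-- A right `K_a`-linear operator on `F`, as an endomorphism of the point module over its own
endomorphism ring: this is the form in which the density theorem approximates it. -/
def endOfRightLinear (A : Module.End (δ.centralizer a)ᵐᵒᵖ F) :
    Module.End (Module.End δ.Poly (δ.PointModule a)) (δ.PointModule a) where
  toFun x := of δ a (A ((of δ a).symm x))
  map_add' _ _ := by simp only [_root_.map_add]
  map_smul' g x := by
    obtain ⟨β, rfl⟩ := (of δ a).surjective x
    let k : δ.centralizer a := ⟨homMultiplier g, D_homMultiplier g⟩
    have hA : A (β * homMultiplier g) = A β * homMultiplier g := A.map_smul (MulOpposite.op k) β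
    simp only [Module.End.smul_def, RingHom.id_apply, hom_of, AddEquiv.symm_apply_apply, hA]

end PointModule

/-- The ring morphism `P ↦ P^{D_a}` onto the ring of linearized polynomials. -/
def toLinPoly (a : Fin n → F) : δ.Poly →+* δ.LinPoly a :=
  (δ.phi a).codRestrict (δ.LinPoly a) fun P => (δ.mem_linSpan a _).2 ⟨P, rfl⟩

theorem toLinPoly_surjective (a : Fin n → F) : Function.Surjective (δ.toLinPoly a) :=
  fun f => ((δ.mem_linSpan a f).1 f.2).imp fun _ hP => Subtype.ext hP

theorem ker_toLinPoly (a : Fin n → F) :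
    RingHom.ker (δ.toLinPoly a) = δ.vanishing (δ.conjClass a) :=
  Ideal.ext fun P => Subtype.ext_iff.trans (δ.mem_vanishing_conjClass a P).symm

/-- Linearized polynomials, as endomorphisms of the right vector space `F` over `K_a`. -/
def linPolyToEnd (a : Fin n → F) : δ.LinPoly a →+* Module.End (δ.centralizer a)ᵐᵒᵖ F where
  toFun f :=
    { toFun := (f : AddMonoid.End F)
      map_add' := _root_.map_add (f : AddMonoid.End F)
      map_smul' := fun k β => by
        obtain ⟨P, rfl⟩ := δ.toLinPoly_surjective a f
        exact δ.phi_mul_of_mem_centralizer P β k.unop.2 }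
  map_zero' := rfl
  map_one' := rfl
  map_add' _ _ := rfl
  map_mul' _ _ := rfl

theorem linPolyToEnd_injective (a : Fin n → F) : Function.Injective (δ.linPolyToEnd a) :=
  fun _ _ h => Subtype.ext (DFunLike.ext _ _ fun β => LinearMap.congr_fun h β)

theorem exists_linPolyToEnd_eq {ι : Type*} [Finite ι] {a : ι → Fin n → F}
    (hconj : Pairwise fun i j => a j ∉ δ.conjClass (a i))
    [hfin : ∀ i, Module.Finite (δ.centralizer (a i))ᵐᵒᵖ F]
    (A : ∀ i, Module.End (δ.centralizer (a i))ᵐᵒᵖ F) :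
    ∃ P : δ.Poly, ∀ i, δ.linPolyToEnd (a i) (δ.toLinPoly (a i) P) = A i := by
  choose s hs using fun i => (hfin i).fg_top
  obtain ⟨P, hP⟩ := jacobson_density_pi
    (fun i j hij => PointModule.hom_eq_zero (hconj hij.symm))
    (fun i => PointModule.endOfRightLinear (A i))
    (fun i => (s i).map (PointModule.of δ (a i)).toEquiv.toEmbedding)
  refine ⟨P, fun i => LinearMap.ext_on (hs i) fun β hβ => ?_⟩
  exact (PointModule.of δ (a i)).injective (hP i _ (Finset.mem_map_of_mem _ hβ)).symm

/-- `F[D_a]` is the full endomorphism ring of the right vector space `F` over `K_a`. -/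
def linPolyEquivEnd (a : Fin n → F) [Module.Finite (δ.centralizer a)ᵐᵒᵖ F] :
    δ.LinPoly a ≃+* Module.End (δ.centralizer a)ᵐᵒᵖ F :=
  RingEquiv.ofBijective (δ.linPolyToEnd a) ⟨δ.linPolyToEnd_injective a, fun A =>
    have ⟨P, hP⟩ := δ.exists_linPolyToEnd_eq (ι := Unit) (a := fun _ => a)
      Subsingleton.pairwise fun _ => A
    ⟨δ.toLinPoly a P, hP ()⟩⟩

section Star

variable {δ} {a : Fin n → F} {M : ℕ} (β : Module.Basis (Fin M) (δ.centralizer a)ᵐᵒᵖ F)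

theorem mu_apply (x : Fin M → F) (i j : Fin M) : mu β x i j = (β.repr (x j) i).unop := rfl

theorem mu_comp (f : Module.End (δ.centralizer a)ᵐᵒᵖ F) (x : Fin M → F) :
    mu β (fun j => f (x j)) = mu β (fun j => f (β j)) * mu β x := by
  refine Matrix.ext fun i j => ?_
  have hfx : β.repr (f (x j)) = ∑ k, β.repr (x j) k • β.repr (f (β k)) := by
    conv_lhs => rw [← β.sum_repr (x j)]
    simp only [map_sum, map_smul]
  simp only [Matrix.mul_apply, mu_apply, hfx, Finsupp.finsetSum_apply, Finsupp.smul_apply,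
    smul_eq_mul, MulOpposite.unop_mul, Finset.unop_sum]

/-- Evaluation on a right basis turns composition of operators into the product `⋆`. -/
def endEquivStarVec : Module.End (δ.centralizer a)ᵐᵒᵖ F ≃+* StarVec β where
  toFun f j := f (β j)
  invFun v := β.constr ℕ v
  left_inv f := β.constr_self ℕ f
  right_inv v := funext (β.constr_basis ℕ v)
  map_add' _ _ := rfl
  map_mul' f g := (muS β).injective ((mu_comp β f fun j => g (β j)).trans (muS_mul β _ _).symm)

/-- `F[D_a] ≅ (F^M, ⋆)`, by evaluation on a right basis. -/
def linPolyEquivStarVec : δ.LinPoly a ≃+* StarVec β :=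
  have := Module.Finite.of_basis β
  (δ.linPolyEquivEnd a).trans (endEquivStarVec β)

/-- `(F^M, ⋆) ≅ K_a^{M × M}`, by `μ_β`. -/
def starVecEquivMatrix : StarVec β ≃+* Matrix (Fin M) (Fin M) (δ.centralizer a) :=
  { muS β with map_mul' := muS_mul β }

end Star

section Quotient

/-- `F[x; σ, δ] / I(C(a)) ≅ F[D_a]`, by `P ↦ P^{D_a}`. -/
def quotientEquivLinPoly (a : Fin n → F) :
    (δ.Poly ⧸ δ.vanishing (δ.conjClass a)) ≃+* δ.LinPoly a :=
  (Ideal.quotEquivOfEq (δ.ker_toLinPoly a).symm).trans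
    (RingHom.quotientKerEquivOfSurjective (δ.toLinPoly_surjective a))

theorem quotientEquivLinPoly_smul (a : Fin n → F) (c : F)
    (x : δ.Poly ⧸ δ.vanishing (δ.conjClass a)) :
    δ.quotientEquivLinPoly a (c • x) = c • δ.quotientEquivLinPoly a x := by
  obtain ⟨P, rfl⟩ := Ideal.Quotient.mk_surjective x
  exact Subtype.ext (δ.phi_smul a c P)

theorem vanishing_iUnion {ι : Type*} (Ω : ι → Set (Fin n → F)) :
    δ.vanishing (⋃ i, Ω i) = ⨅ i, δ.vanishing (Ω i) := by
  ext P
  simp only [Submodule.mem_iInf]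
  exact Set.iUnion_subset_iff (t := {b | δ.eval b P = 0})

variable {ι : Type*} [Finite ι] {a : ι → Fin n → F}
  [∀ i, Module.Finite (δ.centralizer (a i))ᵐᵒᵖ F]

theorem quotientInfToPiQuotient_vanishing_surjective
    (hconj : Pairwise fun i j => a j ∉ δ.conjClass (a i)) : Function.Surjective
    (Ideal.quotientInfToPiQuotient fun i => δ.vanishing (δ.conjClass (a i))) := by
  intro y
  obtain ⟨P, hP⟩ := δ.exists_linPolyToEnd_eq hconj
    fun i => δ.linPolyToEnd (a i) (δ.quotientEquivLinPoly (a i) (y i))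
  exact ⟨Ideal.Quotient.mk _ P, funext fun i =>
    (δ.quotientEquivLinPoly (a i)).injective (δ.linPolyToEnd_injective (a i) (hP i))⟩

/-- `F[x; σ, δ] / I(⋃ᵢ C(aᵢ)) ≅ ∏ᵢ F[x; σ, δ] / I(C(aᵢ))`. -/
def quotientEquivPi (hconj : Pairwise fun i j => a j ∉ δ.conjClass (a i)) :
    (δ.Poly ⧸ δ.vanishing (⋃ i, δ.conjClass (a i))) ≃+*
      ∀ i, δ.Poly ⧸ δ.vanishing (δ.conjClass (a i)) :=
  (Ideal.quotEquivOfEq (δ.vanishing_iUnion fun i => δ.conjClass (a i))).trans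
    (RingEquiv.ofBijective _ ⟨Ideal.quotientInfToPiQuotient_inj _,
      δ.quotientInfToPiQuotient_vanishing_surjective hconj⟩)

theorem quotientEquivPi_smul (hconj : Pairwise fun i j => a j ∉ δ.conjClass (a i)) (c : F)
    (x : δ.Poly ⧸ δ.vanishing (⋃ i, δ.conjClass (a i))) :
    δ.quotientEquivPi hconj (c • x) = c • δ.quotientEquivPi hconj x := by
  obtain ⟨P, rfl⟩ := Ideal.Quotient.mk_surjective x
  rfl

theorem isSemisimpleRing_quotient_vanishing
    (hconj : Pairwise fun i j => a j ∉ δ.conjClass (a i)) :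
    IsSemisimpleRing (δ.Poly ⧸ δ.vanishing (⋃ i, δ.conjClass (a i))) :=
  have (i : ι) : IsSemisimpleRing (Module.End (δ.centralizer (a i))ᵐᵒᵖ F) :=
    IsSemisimpleRing.moduleEnd _ _
  ((δ.quotientEquivPi hconj).trans (RingEquiv.piCongrRight fun i =>
    (δ.quotientEquivLinPoly (a i)).trans (δ.linPolyEquivEnd (a i)))).symm.isSemisimpleRing

end Quotient

end SigmaDerivation

end

theorem mainTheorem7 {F : Type*} [DivisionRing F] {n : ℕ}
    (σ : F →+* Matrix (Fin n) (Fin n) F) (δ : SigmaDerivation σ) {l : ℕ}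
    (a : Fin l → Fin n → F)
    (hconj : Pairwise fun i j => a j ∉ δ.conjClass (a i))
    (hfin : ∀ i, Module.Finite (δ.centralizer (a i))ᵐᵒᵖ F) :
    (∀ β : ∀ i, Module.Basis (Fin (Module.finrank (δ.centralizer (a i))ᵐᵒᵖ F))
        (δ.centralizer (a i))ᵐᵒᵖ F,
      ∃ (e₁ : (δ.Poly ⧸ δ.vanishing (⋃ i, δ.conjClass (a i))) ≃+*
            ∀ i, δ.Poly ⧸ δ.vanishing (δ.conjClass (a i)))
        (e₂ : (∀ i, δ.Poly ⧸ δ.vanishing (δ.conjClass (a i))) ≃+* ∀ i, δ.LinPoly (a i))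
        (e₃ : (∀ i, δ.LinPoly (a i)) ≃+* ∀ i, SigmaDerivation.StarVec (β i))
        (e₄ : (∀ i, SigmaDerivation.StarVec (β i)) ≃+*
            ∀ i, Matrix (Fin (Module.finrank (δ.centralizer (a i))ᵐᵒᵖ F))
              (Fin (Module.finrank (δ.centralizer (a i))ᵐᵒᵖ F)) (δ.centralizer (a i))),
        (∀ (P : δ.Poly) (i : Fin l), e₁ (Ideal.Quotient.mk _ P) i = Ideal.Quotient.mk _ P) ∧
        (∀ (c : F) x, e₁ (c • x) = c • e₁ x) ∧
        (∀ (P : Fin l → δ.Poly) (i : Fin l),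
          (e₂ (fun k => Ideal.Quotient.mk _ (P k)) i : AddMonoid.End F) =
            δ.phi (a i) (P i)) ∧
        (∀ (c : F) x, e₂ (c • x) = c • e₂ x) ∧
        (∀ (f : ∀ i, δ.LinPoly (a i)) (i : Fin l),
          e₃ f i = fun j => (f i : AddMonoid.End F) (β i j)) ∧
        (∀ (c : F) x, e₃ (c • x) = c • e₃ x) ∧
        (∀ (v : ∀ i, SigmaDerivation.StarVec (β i)) (i : Fin l),
          e₄ v i = SigmaDerivation.mu (β i) (v i))) ∧
    IsSemisimpleRing (δ.Poly ⧸ δ.vanishing (⋃ i, δ.conjClass (a i))) ∧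
    ∀ (V : Type*) [AddCommGroup V]
      [Module (δ.Poly ⧸ δ.vanishing (⋃ i, δ.conjClass (a i))) V]
      (W : Submodule (δ.Poly ⧸ δ.vanishing (⋃ i, δ.conjClass (a i))) V),
      ∃ W' : Submodule (δ.Poly ⧸ δ.vanishing (⋃ i, δ.conjClass (a i))) V, IsCompl W W' := by
  refine ⟨fun β =>
    ⟨δ.quotientEquivPi hconj,
      RingEquiv.piCongrRight fun i => δ.quotientEquivLinPoly (a i),
      RingEquiv.piCongrRight fun i => SigmaDerivation.linPolyEquivStarVec (β i),
      RingEquiv.piCongrRight fun i => SigmaDerivation.starVecEquivMatrix (β i),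
      fun _ _ => rfl,
      δ.quotientEquivPi_smul hconj,
      fun _ _ => rfl,
      fun c x => funext fun i => δ.quotientEquivLinPoly_smul (a i) c (x i),
      fun _ _ => rfl,
      fun _ _ => rfl,
      fun _ _ => rfl⟩, ?_⟩
  have hss := δ.isSemisimpleRing_quotient_vanishing hconj
  exact ⟨hss, fun _ _ _ W => exists_isCompl W⟩
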